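/- A simplicial category is a simplicial object $[n]\mapsto \mathbb{S}_n$ in the category $\mathbf{Cat}$ of small categories in which all $\mathbb{S}_n$ have a common set of objects and all operators are identities on objects (equivalently, a category enriched in simplicial sets); morphisms in $\mathbb{S}_n$ are called $n$-arrows. With maps of simplicial objects as morphisms, these form the category $\mathbf{sCat}$. Let $F\dashv U$ be the adjunction between reflexive directed graphs and small categories, where $U$ takes the underlying reflexive directed graph and $F$ the free category on a reflexive directed graph, with unit $\eta$ and counit $\epsilon$. The free resolution of a small category $\mathsf{A}$ is the simplicial category $\mathfrak{C}\mathsf{A}$ with $(\mathfrak{C}\mathsf{A})_n=(FU)^{n+1}\mathsf{A}$, obtained by evaluating the comonad resolution of $(FU,\epsilon,F\eta U)$ at $\mathsf{A}$: its faces are the functors $(FU)^{i}\epsilon(FU)^{n-i}$ and its degeneracies the functors $(FU)^{i}F\eta U(FU)^{n-i}$, for $0\le i\le n$. The homotopy coherent realization $\mathfrak{C}\colon\mathbf{sSet}\to\mathbf{sCat}$ is the pointwise left Kan extension, along the Yoneda embedding $[n]\mapsto\Delta^n$, of the functor $\Delta\to\mathbf{sCat}$ that sends $[n]$ to the free resolution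 $\mathfrak{C}[n]$ of the ordinal category $[n]=(0\to 1\to\cdots\to n)$. Theorem. For any small category $\mathsf{A}$, the free resolution of $\mathsf{A}$ is isomorphic, naturally in $\mathsf{A}$, to the homotopy coherent realization of the nerve of $\mathsf{A}$; that is, the functor $\mathbf{Cat}\to\mathbf{sCat}$ sending $\mathsf{A}$ to its free resolution is naturally isomorphic to the composite of the nerve $\mathbf{Cat}\to\mathbf{sSet}$ with the homotopy coherent realization. -/

import Mathlib

universe v u

namespace HoCoh

open CategoryTheory CategoryTheory.Limits Opposite

section Resolution

/-! ### The comonad resolution -/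

/-- The monotone map `i ↦ f i + 1`. -/
def ordSucc {m n : ℕ} (f : Fin m →o Fin n) : Fin m →o Fin (n + 1) where
  toFun i := (f i).succ
  monotone' _ _ h := Fin.succ_le_succ_iff.2 (f.monotone h)

/-- The monotone map with `0 ↦ 0` and `i + 1 ↦ f i`. -/
def ordCons {m n : ℕ} (f : Fin m →o Fin (n + 1)) : Fin (m + 1) →o Fin (n + 1) where
  toFun := Fin.cons 0 f
  monotone' i j h := by
    induction i using Fin.cases with
    | zero => exact Fin.zero_le _
    | succ i =>
      induction j using Fin.cases with
      | zero => exact absurd h (by simp)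
      | succ j => simpa using f.monotone (Fin.succ_le_succ_iff.1 h)

/-- The monotone map `i ↦ f (i + 1)`. -/
def ordTail {m n : ℕ} (f : Fin (m + 1) →o Fin n) : Fin m →o Fin n where
  toFun i := f i.succ
  monotone' _ _ h := f.monotone (Fin.succ_le_succ_iff.2 h)

/-- The monotone map `i ↦ f i - 1`, if `f` does not take the value `0`. -/
def ordPred {m n : ℕ} (f : Fin m →o Fin (n + 1)) (h : ∀ i, f i ≠ 0) : Fin m →o Fin n where
  toFun i := (f i).pred (h i)
  monotone' _ _ hij := Fin.pred_le_pred_iff.2 (f.monotone hij)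

@[simp] lemma ordSucc_apply {m n : ℕ} (f : Fin m →o Fin n) (i : Fin m) :
    ordSucc f i = (f i).succ := rfl

@[simp] lemma ordCons_zero {m n : ℕ} (f : Fin m →o Fin (n + 1)) : ordCons f 0 = 0 := rfl

@[simp] lemma ordCons_succ {m n : ℕ} (f : Fin m →o Fin (n + 1)) (i : Fin m) :
    ordCons f i.succ = f i := rfl

@[simp] lemma ordTail_apply {m n : ℕ} (f : Fin (m + 1) →o Fin n) (i : Fin m) :
    ordTail f i = f i.succ := rfl

@[simp] lemma ordPred_apply {m n : ℕ} (f : Fin m →o Fin (n + 1)) (h : ∀ i, f i ≠ 0)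
    (i : Fin m) : ordPred f h i = (f i).pred (h i) := rfl

lemma ordCons_ordTail {m n : ℕ} (f : Fin (m + 1) →o Fin (n + 1)) (h : f 0 = 0) :
    ordCons (ordTail f) = f := by
  ext i
  induction i using Fin.cases with
  | zero => simp [h]
  | succ i => simp

lemma ordSucc_ordPred {m n : ℕ} (f : Fin m →o Fin (n + 1)) (h : ∀ i, f i ≠ 0) :
    ordSucc (ordPred f h) = f := by
  ext i
  simp

lemma ord_cases {m n : ℕ} (f : Fin m →o Fin (n + 1)) :
    (∃ f' : Fin m →o Fin n, f = ordSucc f') ∨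
      ∃ (m' : ℕ) (hm : m = m' + 1) (f' : Fin m' →o Fin (n + 1)), hm ▸ f = ordCons f' := by
  by_cases h : ∀ i, f i ≠ 0
  · exact Or.inl ⟨_, (ordSucc_ordPred f h).symm⟩
  · push Not at h
    obtain ⟨i, hi⟩ := h
    obtain _ | m := m
    · exact i.elim0
    · exact Or.inr ⟨m, rfl, _, (ordCons_ordTail f
        (le_antisymm (hi ▸ f.monotone (Fin.zero_le i)) (Fin.zero_le _))).symm⟩

variable {C : Type u} [Category.{v} C] (G : Comonad C)

/-- The `n`-fold iterate `G^n` of the endofunctor of a comonad; the outermost copy of `G`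
is the last one applied. -/
@[reducible] def iter : ℕ → (C ⥤ C)
  | 0 => 𝟭 C
  | n + 1 => iter n ⋙ G.toFunctor

open Classical in
/-- For a monotone map `f` of finite ordinals, from `m` to `n`, the operator `G^n ⟶ G^m` of the
comonad resolution. The copies of `G` are numbered `0, 1, …` from the outside to the inside, and
the copy number `j` in `G^n` is mapped to the block of copies with numbers in `f⁻¹(j)` by the
iterated comultiplication `G ⟶ G^k`, where `k` is the size of `f⁻¹(j)` (so by the counit if
`k = 0` and by the identity if `k = 1`).
The lemmas `comonadResolution_δ` and `comonadResolution_σ` below show that the faces are the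
`G^i ε G^(n-i)` and the degeneracies are the `G^i δ G^(n-i)`. -/
noncomputable def iterMap : (m n : ℕ) → (Fin m →o Fin n) → (iter G n ⟶ iter G m)
  | 0, 0, _ => 𝟙 _
  | _ + 1, 0, f => (f 0).elim0
  | m, n + 1, f =>
      if h : ∀ i, f i ≠ 0 then
        Functor.whiskerLeft (iter G n) G.ε ≫ iterMap m n (ordPred f h)
      else
        match m, f with
        | 0, _ => (h fun i => i.elim0).elim
        | m + 1, f =>
          Functor.whiskerLeft (iter G n) G.δ ≫
            Functor.whiskerRight (iterMap m (n + 1) (ordTail f)) G.toFunctor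
  termination_by m n => m + n

lemma iterMap_zero (f : Fin 0 →o Fin 0) : iterMap G 0 0 f = 𝟙 _ := by
  rw [iterMap]

lemma iterMap_ordSucc_app {m n : ℕ} (f : Fin m →o Fin n) (X : C) :
    (iterMap G m (n + 1) (ordSucc f)).app X =
      G.ε.app ((iter G n).obj X) ≫ (iterMap G m n f).app X := by
  have h : ∀ i, ordSucc f i ≠ 0 := fun i => Fin.succ_ne_zero _
  have e : ordPred (ordSucc f) h = f := by ext i; simp
  rw [iterMap, dif_pos h, e]
  rfl

lemma iterMap_ordCons_app {m n : ℕ} (f : Fin m →o Fin (n + 1)) (X : C) :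
    (iterMap G (m + 1) (n + 1) (ordCons f)).app X =
      G.δ.app ((iter G n).obj X) ≫ G.map ((iterMap G m (n + 1) f).app X) := by
  have h : ¬ ∀ i, ordCons f i ≠ 0 := fun h => h 0 rfl
  have e : ordTail (ordCons f) = f := by ext i; simp
  rw [iterMap, dif_neg h]
  change G.δ.app ((iter G n).obj X) ≫ G.map ((iterMap G m (n + 1) (ordTail (ordCons f))).app X) = _
  rw [e]

lemma iterMap_comp_app {m n p : ℕ} (f : Fin m →o Fin n) (g : Fin n →o Fin p) (X : C) :
    (iterMap G m p (g.comp f)).app X = (iterMap G n p g).app X ≫ (iterMap G m n f).app X := by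
  obtain ⟨N, hN⟩ : ∃ N, N = m + n + p := ⟨_, rfl⟩
  induction N using Nat.strong_induction_on generalizing m n p with
  | _ N ih =>
  obtain _ | p := p
  · obtain _ | n := n
    · obtain _ | m := m
      · rw [iterMap_zero, iterMap_zero, iterMap_zero]
        exact (Category.comp_id _).symm
      · exact (f 0).elim0
    · exact (g 0).elim0
  obtain ⟨g, rfl⟩ | ⟨n, rfl, g, hg⟩ := ord_cases g
  · rw [show (ordSucc g).comp f = ordSucc (g.comp f) from rfl, iterMap_ordSucc_app,
      iterMap_ordSucc_app, ih (m + n + p) (by omega) f g rfl, Category.assoc]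
  · subst hg
    obtain ⟨f, rfl⟩ | ⟨m, rfl, f, hf⟩ := ord_cases f
    · rw [show (ordCons g).comp (ordSucc f) = g.comp f from by
          ext i; simp,
        iterMap_ordCons_app, iterMap_ordSucc_app, ih (m + n + (p + 1)) (by omega) f g rfl,
        Category.assoc, Comonad.counit_naturality_assoc, Comonad.left_counit_assoc]
    · subst hf
      rw [show (ordCons g).comp (ordCons f) = ordCons ((ordCons g).comp f) from by
          ext i
          induction i using Fin.cases with
          | zero => simp
          | succ i => simp,
        iterMap_ordCons_app, ih (m + (n + 1) + (p + 1)) (by omega) f (ordCons g) rfl,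
        iterMap_ordCons_app, iterMap_ordCons_app]
      simp only [Functor.map_comp, Category.assoc, Comonad.delta_naturality_assoc,
        Comonad.coassoc_assoc]

lemma iterMap_id_app (n : ℕ) (X : C) :
    (iterMap G n n OrderHom.id).app X = 𝟙 ((iter G n).obj X) := by
  induction n with
  | zero => rw [iterMap_zero]; rfl
  | succ n ih =>
    have e : (OrderHom.id : Fin (n + 1) →o Fin (n + 1)) = ordCons (ordSucc OrderHom.id) := by
      ext i
      induction i using Fin.cases with
      | zero => simp
      | succ i => simp
    rw [e, iterMap_ordCons_app, iterMap_ordSucc_app, ih]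
    exact (congrArg _ (congrArg _ (Category.comp_id (G.ε.app ((iter G n).obj X))))).trans (G.right_counit _)

/-- The comonad resolution of a comonad `G`: the functor which maps an object `X` to the
simplicial object `n ↦ G^(n+1) X`. -/
noncomputable def comonadResolution : C ⥤ SimplicialObject C where
  obj X :=
    { obj := fun k => (iter G (k.unop.len + 1)).obj X
      map := fun f => (iterMap G _ _ f.unop.toOrderHom).app X
      map_id := fun _ => iterMap_id_app G _ X
      map_comp := fun f g => iterMap_comp_app G g.unop.toOrderHom f.unop.toOrderHom X }
  map φ :=
    { app := fun k => (iter G (k.unop.len + 1)).map φ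
      naturality := fun _ _ f => ((iterMap G _ _ f.unop.toOrderHom).naturality φ).symm }
  map_id X := by ext k; exact (iter G (k.unop.len + 1)).map_id X
  map_comp φ ψ := by ext k; exact (iter G (k.unop.len + 1)).map_comp φ ψ

/-- The whiskered counit `G^i ε G^(n-i) : G^(n+1) X ⟶ G^n X`. -/
def whiskerCounit (X : C) : (n : ℕ) → Fin (n + 1) → ((iter G (n + 1)).obj X ⟶ (iter G n).obj X)
  | n, ⟨0, _⟩ => G.ε.app ((iter G n).obj X)
  | n + 1, ⟨i + 1, h⟩ => G.map (whiskerCounit X n ⟨i, Nat.lt_of_succ_lt_succ h⟩)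

/-- The whiskered comultiplication `G^i δ G^(n-i) : G^(n+1) X ⟶ G^(n+2) X`. -/
def whiskerComult (X : C) :
    (n : ℕ) → Fin (n + 1) → ((iter G (n + 1)).obj X ⟶ (iter G (n + 2)).obj X)
  | n, ⟨0, _⟩ => G.δ.app ((iter G n).obj X)
  | n + 1, ⟨i + 1, h⟩ => G.map (whiskerComult X n ⟨i, Nat.lt_of_succ_lt_succ h⟩)

/-- The faces of the comonad resolution are the whiskered counits. -/
lemma comonadResolution_δ (X : C) (n : ℕ) (i : Fin (n + 2)) :
    ((comonadResolution G).obj X).δ i = whiskerCounit G X (n + 1) i := by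
  have key : ∀ (n : ℕ) (i : Fin (n + 1)),
      (iterMap G n (n + 1) (Fin.succAboveOrderEmb i).toOrderHom).app X =
        whiskerCounit G X n i := by
    intro n
    induction n with
    | zero =>
      intro i
      obtain rfl : i = 0 := Fin.fin_one_eq_zero i
      rw [show (Fin.succAboveOrderEmb (0 : Fin 1)).toOrderHom = ordSucc OrderHom.id from
        OrderHom.ext _ _ (funext fun i => i.elim0), iterMap_ordSucc_app, iterMap_id_app]
      exact Category.comp_id _
    | succ n ih =>
      intro i
      induction i using Fin.cases with
      | zero =>
        rw [show (Fin.succAboveOrderEmb (0 : Fin (n + 2))).toOrderHom = ordSucc OrderHom.id by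
          ext i; simp, iterMap_ordSucc_app, iterMap_id_app]
        exact Category.comp_id _
      | succ i =>
        rw [show (Fin.succAboveOrderEmb i.succ).toOrderHom =
            ordCons (ordSucc (Fin.succAboveOrderEmb i).toOrderHom) by
          ext j
          induction j using Fin.cases with
          | zero => simp
          | succ j => simp,
          iterMap_ordCons_app, iterMap_ordSucc_app, ih, Functor.map_comp,
          Comonad.right_counit_assoc]
        rfl
  exact key (n + 1) i

/-- The degeneracies of the comonad resolution are the whiskered comultiplications. -/
lemma comonadResolution_σ (X : C) (n : ℕ) (i : Fin (n + 1)) :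
    ((comonadResolution G).obj X).σ i = whiskerComult G X n i := by
  have key : ∀ (n : ℕ) (i : Fin (n + 1)),
      (iterMap G (n + 2) (n + 1) (Fin.predAboveOrderHom i)).app X = whiskerComult G X n i := by
    intro n
    induction n with
    | zero =>
      intro i
      obtain rfl : i = 0 := Fin.fin_one_eq_zero i
      rw [show Fin.predAboveOrderHom (0 : Fin 1) = ordCons OrderHom.id from
        OrderHom.ext _ _ (Subsingleton.elim (α := Fin 2 → Fin 1) _ _),
        iterMap_ordCons_app, iterMap_id_app]
      exact (congrArg _ (G.map_id _)).trans (Category.comp_id _)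
    | succ n ih =>
      intro i
      induction i using Fin.cases with
      | zero =>
        rw [show Fin.predAboveOrderHom (0 : Fin (n + 2)) = ordCons OrderHom.id by
          ext j
          induction j using Fin.cases with
          | zero => simp
          | succ j => simp, iterMap_ordCons_app, iterMap_id_app]
        exact (congrArg _ (G.map_id _)).trans (Category.comp_id _)
      | succ i =>
        rw [show Fin.predAboveOrderHom i.succ =
            ordCons (ordSucc (Fin.predAboveOrderHom i)) by
          ext j
          induction j using Fin.cases with
          | zero => simp
          | succ j => simp,
          iterMap_ordCons_app, iterMap_ordSucc_app, ih, Functor.map_comp,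
          Comonad.right_counit_assoc]
        rfl
  exact key n i

end Resolution

section SimplicialCategories

/-! ### Simplicial categories -/

/-- The simplicial objects in `Cat` all of whose operators are bijective on objects. These
bijections identify the sets of objects of all the categories with one common set, so that the
operators become identity-on-objects functors. -/
def constantObjects : ObjectProperty (SimplicialObject Cat.{u, u}) :=
  fun X => ∀ ⦃k l : SimplexCategoryᵒᵖ⦄ (f : k ⟶ l), Function.Bijective (X.map f).toFunctor.obj

/-- The category of (small) simplicial categories: a simplicial category is a simplicial object
`[n] ↦ A_n` in `Cat` (the morphisms of `A_n` are the `n`-arrows) with a common set of objects,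
and a simplicial functor is a map of simplicial objects. -/
abbrev SCat : Type (u + 1) := (constantObjects.{u}).FullSubcategory

/-- The codiscrete category on a type. -/
structure Codisc (A : Type u) : Type u where
  /-- The underlying element. -/
  as : A

instance (A : Type u) : Category.{u} (Codisc A) where
  Hom _ _ := PUnit
  id _ := ⟨⟩
  comp _ _ := ⟨⟩

/-- The functor that sends a type to the codiscrete category on it. -/
def codisc : Type u ⥤ Cat.{u, u} where
  obj A := Cat.of (Codisc A)
  map f := Functor.toCatHom
    { obj := fun x => ⟨f x.as⟩
      map := fun _ => ⟨⟩ }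

/-- The functor of objects is left adjoint to `codisc`. -/
def objectsAdj : Cat.objects.{u, u} ⊣ codisc.{u} := Adjunction.mkOfHomEquiv
  { homEquiv := fun C A =>
      { toFun := fun f => Functor.toCatHom
          { obj := fun x => ⟨f x⟩
            map := fun _ => ⟨⟩ }
        invFun := fun F => ↾fun x => (F.toFunctor.obj x).as
        left_inv := fun _ => rfl
        right_inv := fun _ => rfl }
    homEquiv_naturality_left_symm := fun _ _ => rfl
    homEquiv_naturality_right := fun _ _ => rfl }

lemma constantObjects_iff (X : SimplicialObject Cat.{u, u}) :
    constantObjects X ↔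
      ∀ ⦃k l : SimplexCategoryᵒᵖ⦄ (f : k ⟶ l), IsIso (Cat.objects.map (X.map f)) := by
  simp only [isIso_iff_bijective]
  rfl

instance (J : Type u) [Category.{u} J] :
    (constantObjects.{u}).IsClosedUnderColimitsOfShape J where
  colimitsOfShape_le X hX := by
    obtain ⟨p⟩ := hX
    rw [constantObjects_iff]
    intro k l f
    have : PreservesColimitsOfSize.{u, u} Cat.objects.{u, u} :=
      objectsAdj.leftAdjoint_preservesColimits
    let h (k : SimplexCategoryᵒᵖ) :=
      isColimitOfPreserves ((evaluation SimplexCategoryᵒᵖ Cat.{u, u}).obj k ⋙ Cat.objects)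
        p.isColimit
    let α := Functor.whiskerLeft p.diag
      (Functor.whiskerRight ((evaluation SimplexCategoryᵒᵖ Cat.{u, u}).map f) Cat.objects)
    have hα (j : J) : IsIso (α.app j) := (constantObjects_iff _).1 (p.prop_diag_obj j) f
    have : IsIso α := NatIso.isIso_of_isIso_app α
    have e : (IsColimit.coconePointsIsoOfNatIso (h k) (h l) (asIso α)).hom =
        Cat.objects.map (X.map f) := by
      refine (h k).hom_ext fun j => ?_
      rw [IsColimit.comp_coconePointsIsoOfNatIso_hom]
      change Cat.objects.map _ ≫ Cat.objects.map _ = Cat.objects.map _ ≫ Cat.objects.map _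
      rw [← Functor.map_comp, ← Functor.map_comp]
      exact congrArg (fun g => Cat.objects.map g) ((p.ι.app j).naturality f)
    rw [← e]
    infer_instance

instance : HasColimitsOfSize.{u, u} SCat.{u} where

instance : HasColimitsOfSize.{0, u} SCat.{u} := hasColimitsOfSizeShrink.{0, u, u, u} _

end SimplicialCategories

section Main

/-! ### Free resolutions and homotopy coherent realization -/

/-- The comonad `FU` on `Cat` for the adjunction `F ⊣ U` between the free category on a reflexive
directed graph and the underlying reflexive directed graph of a category. -/
def freeComonad : Comonad Cat.{u, u} := ReflQuiv.adj.{u, u}.toComonad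

lemma FreeRefl.mk_bijective (V : Type u) [ReflQuiver.{u} V] :
    Function.Bijective (Cat.FreeRefl.mk (V := V)) :=
  ⟨fun _ _ h => congrArg (fun x : Cat.FreeRefl V => x.as) h,
    fun x => by induction x with | mk v => exact ⟨v, rfl⟩⟩

lemma freeComonad_map_bijective {A B : Cat.{u, u}} (F : A ⟶ B)
    (hF : Function.Bijective F.toFunctor.obj) :
    Function.Bijective ((freeComonad.map F).toFunctor.obj) :=
  (Function.Bijective.of_comp_iff _ (FreeRefl.mk_bijective A)).1
    ((FreeRefl.mk_bijective B).comp hF)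

lemma freeComonad_ε_bijective (A : Cat.{u, u}) :
    Function.Bijective ((freeComonad.ε.app A).toFunctor.obj) :=
  (Function.Bijective.of_comp_iff _ (FreeRefl.mk_bijective A)).1
    (show Function.Bijective (id : A → A) from Function.bijective_id)

lemma freeComonad_δ_bijective (A : Cat.{u, u}) :
    Function.Bijective ((freeComonad.δ.app A).toFunctor.obj) :=
  (Function.Bijective.of_comp_iff _ (FreeRefl.mk_bijective A)).1
    ((FreeRefl.mk_bijective (Cat.FreeRefl A)).comp (FreeRefl.mk_bijective A))

lemma iterMap_freeComonad_bijective {m n : ℕ} (f : Fin m →o Fin n) (A : Cat.{u, u}) :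
    Function.Bijective (((iterMap freeComonad m n f).app A).toFunctor.obj) := by
  obtain ⟨N, hN⟩ : ∃ N, N = m + n := ⟨_, rfl⟩
  induction N using Nat.strong_induction_on generalizing m n with
  | _ N ih =>
  obtain _ | n := n
  · obtain _ | m := m
    · rw [iterMap_zero]
      exact Function.bijective_id
    · exact (f 0).elim0
  obtain ⟨f, rfl⟩ | ⟨m, rfl, f, hf⟩ := ord_cases f
  · rw [iterMap_ordSucc_app]
    exact (ih (m + n) (by omega) f rfl).comp (freeComonad_ε_bijective _)
  · subst hf
    rw [iterMap_ordCons_app]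
    exact (freeComonad_map_bijective _ (ih (m + (n + 1)) (by omega) f rfl)).comp
      (freeComonad_δ_bijective _)

/-- The free resolution of a small category `A`: the simplicial category whose category of
`n`-arrows is `(FU)^(n+1) A`, with the operators of the comonad resolution for `FU`. -/
noncomputable def freeResolution : Cat.{u, u} ⥤ SCat.{u} :=
  constantObjects.lift (comonadResolution freeComonad)
    fun A _ _ f => iterMap_freeComonad_bijective f.unop.toOrderHom A

/-- The functor `Δ ⥤ Cat` that sends `[n]` to the ordinal category `0 → 1 → ⋯ → n`. -/
def ordinal : SimplexCategory ⥤ Cat.{u, u} where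
  obj k := Cat.of (ULift.{u} (Fin (k.len + 1)))
  map f := f.toOrderHom.uliftMap.monotone.functor.toCatHom

/-- The homotopy coherent simplices: the cosimplicial simplicial category that sends `[n]` to the
free resolution of the ordinal category `[n]`. -/
noncomputable def coherentSimplex : SimplexCategory ⥤ SCat.{u} :=
  ordinal ⋙ freeResolution

instance (F : SimplexCategory ⥤ SCat.{u}) :
    SSet.stdSimplex.{u}.HasPointwiseLeftKanExtension F :=
  inferInstanceAs (uliftYoneda.{u}.HasPointwiseLeftKanExtension F)

/-- Homotopy coherent realization: the pointwise left Kan extension of `[n] ↦ coherentSimplex [n]`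
along the Yoneda embedding `[n] ↦ Δ[n]`. -/
noncomputable def realization : SSet.{u} ⥤ SCat.{u} :=
  SSet.stdSimplex.{u}.pointwiseLeftKanExtension coherentSimplex.{u}

end Main
end HoCoh

/-! The realization of the nerve of `A` is the colimit of the free resolutions of the ordinal
categories `[k]` over all functors `[k] ⥤ A`. So it has to be shown that the free resolution of `A`
is this colimit. The canonical cocone `[k] ⥤ A` becomes a colimit cocone under the nerve, because a
presheaf is the colimit of its simplices. Colimits of simplicial categories are computed levelwise
in `Cat`, and level `n` of the free resolution is `(FU)^(n+1)`; the nerve is fully faithful and so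
reflects colimits. By induction, it therefore suffices that `FU` maps cocones which the nerve sends
to colimits to cocones with the same property: this is `nonempty_isColimit_free`.

For its proof, the simplices of the nerve of `FU A` are expressed through those of the nerve of `A`.
A chain `x` of `m` arrows in `A` gives a chain `freeChain x` of `m` generators in `FU A`, and a
monotone map `α` from `[n]` to `[m]` cuts the latter into `n` paths. Every `n`-simplex arises in
this way (`exists_eq_freeChain`), and two pairs `(α, x)` give the same simplex only if they are
connected by degeneracies and outer faces (`eq_of_freeChain_eq`). Indeed, each pair can be reduced
to one in which no step of `x` is an identity and the endpoints of `x` are reached. A reduced pair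
is recovered from its simplex by means of the functor from `FU A` to the free monoid on the arrows
of `A` that lists the nonidentity arrows of a path. Thus the simplices of the nerve of `FU A` are
obtained from the sets of `m`-simplices of `A` by a quotient that is natural in `A`, and colimits of
sets commute with that. -/

namespace HoCoh

open CategoryTheory CategoryTheory.Limits Opposite

/-! ### Chains of generators in a free category -/

section FreeChains

variable {C : Type u} [Category.{v} C]

/-- For a chain `x` of `m` composable arrows, the chain of the same `m` arrows, seen as generators
of the free category. An arrow `i ⟶ j` is sent to the path of the steps of `x` from `i` to `j`, not
to the generator given by their composite; identity arrows become identities. -/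
noncomputable def freeChain {m : ℕ} (x : Fin (m + 1) ⥤ C) : Fin (m + 1) ⥤ Cat.FreeRefl C :=
  ComposableArrows.mkOfObjOfMapSucc (fun i => Cat.FreeRefl.mk (x.obj i))
    fun i => Cat.FreeRefl.homMk (x.map (homOfLE i.castSucc_le_succ))

lemma homMk_map_self {D : Type*} [Category* D] (x : D ⥤ C) {i : D} (f : i ⟶ i) (hf : f = 𝟙 i) :
    Cat.FreeRefl.homMk (x.map f) = 𝟙 (Cat.FreeRefl.mk (x.obj i)) := by
  rw [hf, x.map_id]
  exact Cat.FreeRefl.homMk_id _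

/-- On arrows of length at most one, a chain of generators is computed by `homMk`. -/
lemma freeChain_map {m : ℕ} (x : Fin (m + 1) ⥤ C) {i j : Fin (m + 1)} (f : i ⟶ j)
    (h : (j : ℕ) ≤ i + 1) : (freeChain x).map f = Cat.FreeRefl.homMk (x.map f) := by
  obtain hij | hij := (leOfHom f).eq_or_lt
  · subst hij
    rw [homMk_map_self x f (Subsingleton.elim _ _), Subsingleton.elim f (𝟙 i)]
    exact (freeChain x).map_id i
  · obtain ⟨i, hi⟩ := i
    obtain ⟨j, hj⟩ := j
    obtain rfl : j = i + 1 := le_antisymm h hij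
    exact ComposableArrows.mkOfObjOfMapSucc_map_succ _ _ i (by omega)

/-- Comparing steps in the arrow category avoids transports along equalities of objects. -/
lemma chain_ext {D : Type*} [Category* D] {n : ℕ} {F G : Fin (n + 1) ⥤ D} (h₀ : F.obj 0 = G.obj 0)
    (h : ∀ i : Fin n, Arrow.mk (F.map (homOfLE i.castSucc_le_succ)) =
      Arrow.mk (G.map (homOfLE i.castSucc_le_succ))) : F = G := by
  have h' (i) : F.obj i = G.obj i := by
    induction i using Fin.cases with
    | zero => exact h₀
    | succ i => exact congrArg (fun f : Arrow D => f.right) (h i)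
  refine ComposableArrows.ext h' fun i hi => ?_
  obtain ⟨e₁, e₂, e⟩ := (Arrow.mk_eq_mk_iff _ _).1 (h ⟨i, hi⟩)
  exact e

/-- Free chains commute with the monotone maps `f` whose steps are at most one, that is, with
degeneracies and outer faces. They do not commute with inner faces, which compose arrows. -/
lemma freeChain_comp {m m' : ℕ} (f : Fin (m + 1) →o Fin (m' + 1))
    (hf : ∀ i : Fin m, (f i.succ : ℕ) ≤ f i.castSucc + 1) (x : Fin (m' + 1) ⥤ C) :
    freeChain (f.monotone.functor ⋙ x) = f.monotone.functor ⋙ freeChain x := by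
  refine chain_ext rfl fun i => congrArg Arrow.mk ?_
  refine (freeChain_map _ _ le_rfl).trans ?_
  exact (freeChain_map x (f.monotone.functor.map _) (hf i)).symm

lemma freeChain_naturality {D : Type u} [Category.{v} D] (F : C ⥤ D) {m : ℕ}
    (x : Fin (m + 1) ⥤ C) :
    freeChain x ⋙ Cat.freeReflMap F.toReflPrefunctor = freeChain (x ⋙ F) := by
  refine chain_ext rfl fun i => congrArg Arrow.mk ?_
  refine (congrArg _ (freeChain_map x _ le_rfl)).trans ?_
  exact (freeChain_map (x ⋙ F) _ le_rfl).symm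

/-! ### Simplices of the nerve of a free category come from chains -/

/-- Induction on a morphism of the free category with fixed target, adding generators on the
left. -/
lemma freeRefl_hom_induction_left {V : Type*} [ReflQuiver V] {z : V}
    {motive : ∀ {x : V}, (Cat.FreeRefl.mk x ⟶ Cat.FreeRefl.mk z) → Prop}
    (id : motive (𝟙 (Cat.FreeRefl.mk z)))
    (homMk_comp : ∀ {x y : V} (g : x ⟶ y) (f : Cat.FreeRefl.mk y ⟶ Cat.FreeRefl.mk z),
      motive f → motive (Cat.FreeRefl.homMk g ≫ f))
    {x : V} (f : Cat.FreeRefl.mk x ⟶ Cat.FreeRefl.mk z) : motive f := by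
  -- The induction principle of Mathlib adds generators on the right, so a morphism is decomposed
  -- from the right and moved step by step to the front of `g`.
  have key : ∀ {X Y : Cat.FreeRefl V} (f : X ⟶ Y) (x y : V) (hx : X = .mk x) (hy : Y = .mk y)
      (g : Cat.FreeRefl.mk y ⟶ Cat.FreeRefl.mk z), motive g →
        motive (eqToHom hx.symm ≫ f ≫ eqToHom hy ≫ g) := by
    intro X Y f
    induction f using Cat.FreeRefl.hom_induction with
    | id a =>
      intro x y hx hy g hg
      obtain rfl : a = x := congrArg (fun x : Cat.FreeRefl _ => x.as) hx
      obtain rfl : a = y := congrArg (fun x : Cat.FreeRefl _ => x.as) hy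
      simpa using hg
    | @comp_homMk a b c f e ih =>
      intro x y hx hy g hg
      obtain rfl : c = y := congrArg (fun x : Cat.FreeRefl _ => x.as) hy
      simpa using ih x b hx rfl _ (homMk_comp e g hg)
  simpa using key f x z rfl rfl _ id

lemma arrowMk_comp_congr {D : Type*} [Category* D] {a b c c' : D} (f : a ⟶ b) {p : b ⟶ c}
    {q : b ⟶ c'} (h : Arrow.mk p = Arrow.mk q) : Arrow.mk (f ≫ p) = Arrow.mk (f ≫ q) := by
  obtain rfl : c = c' := congrArg (fun f : Arrow D => f.right) h
  rw [(Arrow.mk_inj _ _).1 h]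

lemma precomp_id_eq {D : Type*} [Category* D] {n : ℕ} (F : Fin (n + 1) ⥤ D) :
    ComposableArrows.precomp F (𝟙 (ComposableArrows.left F)) =
      (Fin.predAboveOrderHom (0 : Fin (n + 1))).monotone.functor ⋙ F := by
  refine chain_ext rfl fun i => ?_
  induction i using Fin.cases with
  | zero => exact congrArg Arrow.mk (F.map_id 0).symm
  | succ i => rfl

/-- Every simplex of the nerve of the free category is a chain of generators restricted along a
monotone map. The map is normalized to send `0` to `0`, so that paths can be prepended. -/
lemma exists_eq_freeChain {n : ℕ} (β : Fin (n + 1) ⥤ Cat.FreeRefl C) :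
    ∃ (m : ℕ) (α : Fin n →o Fin (m + 1)) (x : Fin (m + 1) ⥤ C),
      β = (ordCons α).monotone.functor ⋙ freeChain x := by
  induction n with
  | zero =>
    refine ⟨0, ⟨fun i => i.elim0, fun i => i.elim0⟩, ComposableArrows.mk₀ (β.obj 0).as, ?_⟩
    exact ComposableArrows.ext₀ rfl
  | succ n ih =>
    obtain ⟨β, b, p, rfl⟩ := ComposableArrows.precomp_surjective β
    obtain ⟨m, α, x, rfl⟩ := ih β
    induction b with | mk b =>
    change Cat.FreeRefl.mk b ⟶ Cat.FreeRefl.mk (x.obj 0) at p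
    induction p using freeRefl_hom_induction_left with
    | id =>
      refine ⟨m, ordCons α, x, ?_⟩
      refine (precomp_id_eq _).trans ?_
      change ((ordCons α).comp (Fin.predAboveOrderHom (0 : Fin (n + 1)))).monotone.functor ⋙
        freeChain x = _
      congr
      ext i
      induction i using Fin.cases with
      | zero => rfl
      | succ i => rfl
    | @homMk_comp a b e p hp =>
      obtain ⟨m', α', x', h⟩ := hp
      -- By induction the chain with first path `p` is represented by `x'`. Prepending `e` to `x'`
      -- and cutting one step later everywhere except at `0` represents the one with first path
      -- `e ≫ p`.
      obtain rfl : b = x'.obj 0 := congrArg (fun x : Cat.FreeRefl _ => x.as) (Functor.congr_obj h 0)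
      refine ⟨m' + 1, ordSucc α', ComposableArrows.precomp x' e, ?_⟩
      have hx : (Fin.succOrderEmb (m' + 1)).toOrderHom.monotone.functor ⋙
          freeChain (ComposableArrows.precomp x' e) = freeChain x' :=
        (freeChain_comp _ (fun _ => le_rfl) _).symm
      rw [← hx] at h
      have h' (i j) (hij : i ≤ j) := congrArg
        (fun F : Fin (n + 2) ⥤ Cat.FreeRefl C => Arrow.mk (F.map (homOfLE hij))) h
      refine chain_ext rfl fun i => ?_
      induction i using Fin.cases with
      | zero =>
        refine (arrowMk_comp_congr (Cat.FreeRefl.homMk e) (h' 0 1 (Fin.zero_le _))).trans ?_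
        refine congrArg Arrow.mk ?_
        refine (congrArg (· ≫ _) (freeChain_map (ComposableArrows.precomp x' e)
          (homOfLE (Fin.zero_le 1)) le_rfl).symm).trans ?_
        exact (Functor.map_comp _ _ _).symm
      | succ i => exact h' i.succ.castSucc i.succ.succ (Fin.castSucc_le_succ _)

end FreeChains

/-! ### Reduced representatives and their uniqueness -/

section ReducedChains

variable {C : Type u} [Category.{v} C]

/-- The arrow `f` is an identity, where source and target are only required to be equal, not
definitionally so. -/
def IsIdArrow {a b : C} (f : a ⟶ b) : Prop := ∃ h : a = b, f = eqToHom h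

lemma isIdArrow_id (a : C) : IsIdArrow (𝟙 a) := ⟨rfl, rfl⟩

lemma functor_eq_of_isIdArrow {J D : Type*} [Category* J] [Category* D] {F G : J ⥤ D} (τ : F ⟶ G)
    (h : ∀ j, ∃ e : F.obj j = G.obj j, τ.app j = eqToHom e) : F = G := by
  choose e he using h
  refine CategoryTheory.Functor.ext e fun i j f => ?_
  have := τ.naturality f
  rw [he, he] at this
  rw [← Category.assoc, ← this, Category.assoc, eqToHom_trans, eqToHom_refl, Category.comp_id]

lemma val_predAbove {m : ℕ} (i : Fin (m + 1)) (j : Fin (m + 2)) :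
    (i.predAbove j : ℕ) = if (i : ℕ) < j then (j : ℕ) - 1 else j := by
  unfold Fin.predAbove
  simp only [Fin.lt_def, Fin.val_castSucc]
  split_ifs <;> simp

lemma val_succAbove {m : ℕ} (i : Fin (m + 1)) (j : Fin m) :
    (i.succAbove j : ℕ) = if (j : ℕ) < i then (j : ℕ) else j + 1 := by
  unfold Fin.succAbove
  simp only [Fin.lt_def, Fin.val_castSucc]
  split_ifs <;> simp

/-- A chain whose `i`-th step is an identity is the `i`-th degeneracy of one of its faces. -/
lemma eq_σ_comp_δ_comp {m : ℕ} (x : Fin (m + 2) ⥤ C) (i : Fin (m + 1))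
    (hi : IsIdArrow (x.map (homOfLE i.castSucc_le_succ))) :
    x = (Fin.predAboveOrderHom i).monotone.functor ⋙
      (Fin.succAboveOrderEmb i.succ).toOrderHom.monotone.functor ⋙ x := by
  have hε (j : Fin (m + 2)) : i.succ.succAbove (i.predAbove j) = j ∨
      (i.succ.succAbove (i.predAbove j) = i.castSucc ∧ j = i.succ) := by
    simp only [Fin.ext_iff, val_succAbove, val_predAbove, Fin.val_succ, Fin.val_castSucc]
    split_ifs <;> omega
  have hle (j : Fin (m + 2)) : i.succ.succAbove (i.predAbove j) ≤ j := by
    obtain h | ⟨h, hj⟩ := hε j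
    · exact h.le
    · rw [h, hj]
      exact i.castSucc_le_succ
  have hmap {k j : Fin (m + 2)} (hkj : k ≤ j) (h : k = j ∨ (k = i.castSucc ∧ j = i.succ)) :
      IsIdArrow (x.map (homOfLE hkj)) := by
    obtain rfl | ⟨rfl, rfl⟩ := h
    · exact ⟨rfl, x.map_id _⟩
    · exact hi
  -- The endomap `δ ∘ σ` lies below the identity and differs from it only at `i.succ`, so the arrows
  -- of `x` give a natural transformation with identity components.
  refine (functor_eq_of_isIdArrow (F := (Fin.predAboveOrderHom i).monotone.functor ⋙
      (Fin.succAboveOrderEmb i.succ).toOrderHom.monotone.functor ⋙ x)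
    { app := fun j => x.map (homOfLE (hle j))
      naturality := fun j k f => ?_ } fun j => hmap (hle j) (hε j)).symm
  exact (x.map_comp _ _).symm.trans (x.map_comp (homOfLE (hle j)) f)

/-- The pair of a monotone map `α` and a chain `x` is reduced if the endpoints of the chain are
reached and no step of the chain is an identity. -/
structure IsReduced {n m : ℕ} (α : Fin (n + 1) →o Fin (m + 1)) (x : Fin (m + 1) ⥤ C) : Prop where
  /-- The first vertex is reached. -/
  map_zero : α 0 = 0
  /-- The last vertex is reached. -/
  map_last : α (Fin.last n) = Fin.last m
  /-- No step is an identity. -/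
  not_isIdArrow (i : Fin m) : ¬ IsIdArrow (x.map (homOfLE i.castSucc_le_succ))

/-- Any quantity `P` of pairs that is invariant under moving a degeneracy or an outer face from
the chain to the monotone map can be computed on a reduced pair. -/
lemma exists_isReduced {S : Type*} {n : ℕ}
    (P : ∀ m, (Fin (n + 1) →o Fin (m + 1)) → (Fin (m + 1) ⥤ C) → S)
    (hP : ∀ {m m'} (α : Fin (n + 1) →o Fin (m + 1)) (f : Fin (m + 1) →o Fin (m' + 1))
      (_ : ∀ i : Fin m, (f i.succ : ℕ) ≤ f i.castSucc + 1) (x : Fin (m' + 1) ⥤ C),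
      P m α (f.monotone.functor ⋙ x) = P m' (f.comp α) x)
    (m : ℕ) (α : Fin (n + 1) →o Fin (m + 1)) (x : Fin (m + 1) ⥤ C) :
    ∃ m' α' x', IsReduced (n := n) (m := m') α' x' ∧ P m α x = P m' α' x' := by
  induction m with
  | zero =>
    exact ⟨0, α, x, ⟨Subsingleton.elim (α := Fin 1) _ _, Subsingleton.elim (α := Fin 1) _ _,
      fun i => i.elim0⟩, rfl⟩
  | succ m ih =>
    -- Shorten the chain by an outer face if an endpoint is missed, else by a degeneracy if some
    -- step is an identity.
    by_cases h₀ : α 0 = 0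
    swap
    · have hα (i) : α i ≠ 0 := fun h =>
        h₀ (le_antisymm (h ▸ α.monotone (Fin.zero_le i)) (Fin.zero_le _))
      obtain ⟨m', α', x', h, e⟩ := ih (ordPred α hα)
        ((Fin.succOrderEmb (m + 1)).toOrderHom.monotone.functor ⋙ x)
      refine ⟨m', α', x', h, Eq.trans ?_ e⟩
      rw [hP]
      · congr 1
        exact (ordSucc_ordPred α hα).symm
      · exact fun _ => le_rfl
    by_cases h₁ : α (Fin.last n) = Fin.last (m + 1)
    swap
    · have hα (i) : α i ≠ Fin.last (m + 1) := fun h =>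
        h₁ (le_antisymm (Fin.le_last _) (h ▸ α.monotone (Fin.le_last i)))
      obtain ⟨m', α', x', h, e⟩ := ih
        { toFun := fun i => (α i).castPred (hα i)
          monotone' := fun _ _ hij => Fin.castPred_le_castPred_iff.2 (α.monotone hij) }
        (Fin.castSuccOrderEmb.toOrderHom.monotone.functor ⋙ x)
      refine ⟨m', α', x', h, Eq.trans ?_ e⟩
      rw [hP]
      · congr 1
      · exact fun _ => le_rfl
    by_cases hx : ∃ i : Fin (m + 1), IsIdArrow (x.map (homOfLE i.castSucc_le_succ))
    · obtain ⟨i, hi⟩ := hx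
      obtain ⟨m', α', x', h, e⟩ := ih ((Fin.predAboveOrderHom i).comp α)
        ((Fin.succAboveOrderEmb i.succ).toOrderHom.monotone.functor ⋙ x)
      refine ⟨m', α', x', h, Eq.trans ?_ e⟩
      rw [← hP α, ← eq_σ_comp_δ_comp x i hi]
      intro j
      simp only [Fin.predAboveOrderHom_coe, val_predAbove, Fin.val_succ, Fin.val_castSucc]
      split_ifs <;> omega
    · exact ⟨m + 1, α, x, ⟨h₀, h₁, fun i hi => hx ⟨i, hi⟩⟩, rfl⟩

/-! ### The word of nonidentity arrows underlying a morphism -/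

open Classical in
/-- The word of length at most one given by an arrow: empty if the arrow is an identity. -/
noncomputable def arrowWord {a b : C} (f : a ⟶ b) : FreeMonoid (Arrow C) :=
  if IsIdArrow f then 1 else FreeMonoid.of (Arrow.mk f)

/-- The functor that sends a path to the word of its nonidentity arrows. It is well defined on the
free category since identities give the empty word. As `f ≫ g` is `g * f` in `SingleObj`, the words
list the arrows from the last to the first. -/
noncomputable def wordFunctor (C : Type u) [Category.{v} C] :
    Cat.FreeRefl C ⥤ SingleObj (FreeMonoid (Arrow C)) :=
  Cat.FreeRefl.lift' (fun _ => SingleObj.star _) (fun f => arrowWord f)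
    fun a => if_pos (isIdArrow_id a)

/-- The word of nonidentity arrows of `F.map f`, typed independently of the endpoints so that
words along equal functors can be compared. -/
noncomputable def word {J : Type*} [Category* J] (F : J ⥤ Cat.FreeRefl C) {i j : J} (f : i ⟶ j) :
    FreeMonoid (Arrow C) :=
  (wordFunctor C).map (F.map f)

lemma wordFunctor_map_homMk {a b : C} (f : a ⟶ b) :
    (wordFunctor C).map (Cat.FreeRefl.homMk f) = arrowWord f :=
  Cat.FreeRefl.lift'_map _ _ _ f

lemma word_comp {J : Type*} [Category* J] (F : J ⥤ Cat.FreeRefl C) {i j k : J} (f : i ⟶ j)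
    (g : j ⟶ k) : word F (f ≫ g) = word F g * word F f := by
  simp only [word, Functor.map_comp, SingleObj.comp_as_mul]

lemma word_self {J : Type*} [Category* J] (F : J ⥤ Cat.FreeRefl C) (i : J) :
    word F (𝟙 i) = 1 := by
  rw [word, F.map_id, (wordFunctor C).map_id]
  rfl

lemma word_succ {m : ℕ} {x : Fin (m + 1) ⥤ C} {i : Fin (m + 1)} {j : Fin m} (h : i ≤ j.castSucc)
    (hx : ¬ IsIdArrow (x.map (homOfLE j.castSucc_le_succ))) :
    word (freeChain x) (homOfLE (h.trans j.castSucc_le_succ)) =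
      FreeMonoid.of (Arrow.mk (x.map (homOfLE j.castSucc_le_succ))) *
        word (freeChain x) (homOfLE h) := by
  rw [show homOfLE (h.trans j.castSucc_le_succ) = homOfLE h ≫ homOfLE j.castSucc_le_succ from rfl,
    word_comp]
  congr 1
  rw [word, freeChain_map _ _ le_rfl]
  exact (wordFunctor_map_homMk _).trans (if_neg hx)

/-- If no step of `x` is an identity, the word from `0` to `j` has length `j`; so word lengths
recover the monotone map of a reduced pair. -/
lemma length_word {m : ℕ} {x : Fin (m + 1) ⥤ C}
    (hx : ∀ i : Fin m, ¬ IsIdArrow (x.map (homOfLE i.castSucc_le_succ))) (j : Fin (m + 1)) :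
    (word (freeChain x) (homOfLE (Fin.zero_le j))).length = j := by
  induction j using Fin.induction with
  | zero => exact congrArg FreeMonoid.length (word_self _ _)
  | succ j ih =>
    rw [word_succ (Fin.zero_le _) (hx j), FreeMonoid.length_mul, FreeMonoid.length_of, ih]
    simp [add_comm]

lemma arrow_eq_of_word_eq {m : ℕ} {x x' : Fin (m + 1) ⥤ C}
    (hx : ∀ i : Fin m, ¬ IsIdArrow (x.map (homOfLE i.castSucc_le_succ)))
    (hx' : ∀ i : Fin m, ¬ IsIdArrow (x'.map (homOfLE i.castSucc_le_succ)))
    (j : Fin (m + 1)) (h : word (freeChain x) (homOfLE (Fin.zero_le j)) =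
      word (freeChain x') (homOfLE (Fin.zero_le j))) (i : Fin m) (hi : i.castSucc < j) :
    Arrow.mk (x.map (homOfLE i.castSucc_le_succ)) =
      Arrow.mk (x'.map (homOfLE i.castSucc_le_succ)) := by
  induction j using Fin.induction with
  | zero => exact absurd hi (by simp)
  | succ j ih =>
    rw [word_succ (Fin.zero_le _) (hx j), word_succ (Fin.zero_le _) (hx' j)] at h
    obtain ⟨h₁, h₂⟩ := List.cons.inj h
    obtain hij | hij := (Fin.le_castSucc_iff.2 hi).lt_or_eq
    · exact ih h₂ hij
    · obtain rfl := Fin.castSucc_injective _ hij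
      exact h₁

lemma IsReduced.word_zero {n m : ℕ} {α : Fin (n + 1) →o Fin (m + 1)} {x : Fin (m + 1) ⥤ C}
    (h : IsReduced α x) (i : Fin (n + 1)) :
    word (α.monotone.functor ⋙ freeChain x) (homOfLE (Fin.zero_le i)) =
      word (freeChain x) (homOfLE (Fin.zero_le (α i))) := by
  have key (k : Fin (m + 1)) (hk : k = 0) (hki : k ≤ α i) : word (freeChain x) (homOfLE hki) =
      word (freeChain x) (homOfLE (Fin.zero_le (α i))) := by
    subst hk
    rfl
  exact key (α 0) h.map_zero _

/-- A reduced pair is determined by the simplex that it represents. The conclusion is stated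
through an arbitrary function `P` of pairs, because the lengths of the chains are only
propositionally equal. -/
lemma IsReduced.eq {n m m' : ℕ} {α : Fin (n + 1) →o Fin (m + 1)} {x : Fin (m + 1) ⥤ C}
    {α' : Fin (n + 1) →o Fin (m' + 1)} {x' : Fin (m' + 1) ⥤ C} (h : IsReduced α x)
    (h' : IsReduced α' x')
    (e : α.monotone.functor ⋙ freeChain x = α'.monotone.functor ⋙ freeChain x')
    {S : Type*} (P : ∀ m, (Fin (n + 1) →o Fin (m + 1)) → (Fin (m + 1) ⥤ C) → S) :
    P m α x = P m' α' x' := by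
  have hw (i) : word (freeChain x) (homOfLE (Fin.zero_le (α i))) =
      word (freeChain x') (homOfLE (Fin.zero_le (α' i))) := by
    rw [← h.word_zero, ← h'.word_zero, e]
  have hα (i) : (α i : ℕ) = α' i := by
    rw [← length_word h.not_isIdArrow, ← length_word h'.not_isIdArrow, hw]
  obtain rfl : m = m' := by simpa [h.map_last, h'.map_last] using hα (Fin.last n)
  obtain rfl : α = α' := OrderHom.ext _ _ (funext fun i => Fin.ext (hα i))
  have hw := hw (Fin.last n)
  -- For chains of length zero there are no arrows, so the initial vertex is compared separately.
  have hx₀ : x.obj 0 = x'.obj 0 := by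
    have := Functor.congr_obj e 0
    rw [← h.map_zero]
    exact congrArg (fun x : Cat.FreeRefl C => x.as) this
  have : x = x' := chain_ext hx₀ fun i => arrow_eq_of_word_eq h.not_isIdArrow h'.not_isIdArrow
    _ hw i (h.map_last ▸ i.castSucc_lt_last)
  rw [this]

/-- Two pairs representing the same simplex of the nerve of the free category are connected by
degeneracies and outer faces: every invariant `P` takes the same value on them. -/
theorem eq_of_freeChain_eq {S : Type*} {n : ℕ}
    (P : ∀ m, (Fin (n + 1) →o Fin (m + 1)) → (Fin (m + 1) ⥤ C) → S)
    (hP : ∀ {m m'} (α : Fin (n + 1) →o Fin (m + 1)) (f : Fin (m + 1) →o Fin (m' + 1))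
      (_ : ∀ i : Fin m, (f i.succ : ℕ) ≤ f i.castSucc + 1) (x : Fin (m' + 1) ⥤ C),
      P m α (f.monotone.functor ⋙ x) = P m' (f.comp α) x)
    {m m' : ℕ} {α : Fin (n + 1) →o Fin (m + 1)} {x : Fin (m + 1) ⥤ C}
    {α' : Fin (n + 1) →o Fin (m' + 1)} {x' : Fin (m' + 1) ⥤ C}
    (e : α.monotone.functor ⋙ freeChain x = α'.monotone.functor ⋙ freeChain x') :
    P m α x = P m' α' x' := by
  -- Pairing `P` with the represented simplex makes the reduction preserve both at once.
  let Q (m : ℕ) (α : Fin (n + 1) →o Fin (m + 1)) (x : Fin (m + 1) ⥤ C) :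
      S × (Fin (n + 1) ⥤ Cat.FreeRefl C) := (P m α x, α.monotone.functor ⋙ freeChain x)
  have hQ : ∀ {m m'} (α : Fin (n + 1) →o Fin (m + 1)) (f : Fin (m + 1) →o Fin (m' + 1))
      (_ : ∀ i : Fin m, (f i.succ : ℕ) ≤ f i.castSucc + 1) (x : Fin (m' + 1) ⥤ C),
      Q m α (f.monotone.functor ⋙ x) = Q m' (f.comp α) x := fun α f hf x =>
    Prod.ext (hP α f hf x) (congrArg (α.monotone.functor ⋙ ·) (freeChain_comp f hf x))
  obtain ⟨k, β, y, h, hy⟩ := exists_isReduced Q hQ m α x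
  obtain ⟨k', β', y', h', hy'⟩ := exists_isReduced Q hQ m' α' x'
  refine (congrArg Prod.fst hy).trans (Eq.trans ?_ (congrArg Prod.fst hy').symm)
  exact h.eq h' ((congrArg Prod.snd hy).symm.trans (e.trans (congrArg Prod.snd hy'))) P

end ReducedChains

/-! ### Colimits detected by the nerve -/

section NerveColimits

/-- The functor of `m`-simplices of the nerve. -/
abbrev simplices (m : ℕ) : Cat.{u, u} ⥤ Type u :=
  nerveFunctor ⋙ (evaluation _ _).obj (op (SimplexCategory.mk m))

/-- The `m`-simplices of the nerve of `A` map to the `n`-simplices of the nerve of `FU A`, by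
restricting the free chain along `α`. -/
noncomputable def freeSimplex {n m : ℕ} (α : Fin (n + 1) →o Fin (m + 1)) :
    simplices.{u} m ⟶ freeComonad.{u}.toFunctor ⋙ simplices n where
  app A := ↾fun x : Fin (m + 1) ⥤ A => (α.monotone.functor ⋙ freeChain x : Fin (n + 1) ⥤ _)
  naturality A B F := by
    ext x
    exact congrArg (α.monotone.functor ⋙ ·) (freeChain_naturality F.toFunctor x).symm

/-- The simplicial operator of the nerve given by a monotone map. -/
def restrictSimplex {m m' : ℕ} (f : Fin (m + 1) →o Fin (m' + 1)) :
    simplices.{u} m' ⟶ simplices m where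
  app A := ↾fun x : Fin (m' + 1) ⥤ A => (f.monotone.functor ⋙ x : Fin (m + 1) ⥤ A)

lemma restrictSimplex_comp_freeSimplex {n m m' : ℕ} (α : Fin (n + 1) →o Fin (m + 1))
    (f : Fin (m + 1) →o Fin (m' + 1)) (hf : ∀ i : Fin m, (f i.succ : ℕ) ≤ f i.castSucc + 1) :
    restrictSimplex f ≫ freeSimplex.{u} α = freeSimplex (f.comp α) := by
  ext A x
  exact congrArg (α.monotone.functor ⋙ ·) (freeChain_comp f hf x)

lemma exists_freeSimplex_eq {n : ℕ} {A : Cat.{u, u}}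
    (y : (freeComonad.{u}.toFunctor ⋙ simplices n).obj A) :
    ∃ (m : ℕ) (α : Fin (n + 1) →o Fin (m + 1)) (x : (simplices m).obj A),
      y = (freeSimplex α).app A x := by
  obtain ⟨m, α, x, h⟩ := exists_eq_freeChain (C := A) y
  exact ⟨m, ordCons α, x, h⟩

variable {J : Type*} [Category* J] {D : J ⥤ Cat.{u, u}} (c : Cocone D)

/-- If the nerve sends a cocone in `Cat` to a colimit cocone, then so does the composite of `FU`
with the nerve, although `FU` does not preserve colimits in general. -/
theorem nonempty_isColimit_free (h : ∀ m, Nonempty (IsColimit ((simplices m).mapCocone c)))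
    (n : ℕ) :
    Nonempty (IsColimit ((freeComonad.toFunctor ⋙ simplices n).mapCocone c)) := by
  let hc (m : ℕ) := (h m).some
  -- The induced map on simplices represented by a pair `(α, x)`, as a function of the chain `x`.
  let G (s : Cocone (D ⋙ freeComonad.toFunctor ⋙ simplices n)) (m : ℕ)
      (α : Fin (n + 1) →o Fin (m + 1)) : (simplices m).obj c.pt ⟶ s.pt :=
    (hc m).desc ((Cocone.precompose (Functor.whiskerLeft D (freeSimplex α))).obj s)
  have G_fac (s) (m) (α) (j) (x : (simplices m).obj (D.obj j)) :
      G s m α ((simplices m).map (c.ι.app j) x) = s.ι.app j ((freeSimplex α).app _ x) :=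
    ConcreteCategory.congr_hom ((hc m).fac
      ((Cocone.precompose (Functor.whiskerLeft D (freeSimplex α))).obj s) j) x
  have G_restrict (s) {m m'} (α : Fin (n + 1) →o Fin (m + 1)) (f : Fin (m + 1) →o Fin (m' + 1))
      (hf : ∀ i : Fin m, (f i.succ : ℕ) ≤ f i.castSucc + 1) (x : (simplices m').obj c.pt) :
      G s m α ((restrictSimplex f).app c.pt x) = G s m' (f.comp α) x := by
    obtain ⟨j, x, rfl⟩ := Types.jointly_surjective _ (hc m') x
    refine Eq.trans ?_ (G_fac s m' (f.comp α) j x).symm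
    rw [← restrictSimplex_comp_freeSimplex _ _ hf]
    exact G_fac s m α j ((restrictSimplex f).app _ x)
  choose M α x hx using fun y => exists_freeSimplex_eq (n := n) (A := c.pt) y
  -- Hence the induced map depends only on the simplex represented by the pair.
  have G_eq (s) {m} (β : Fin (n + 1) →o Fin (m + 1)) (y : (simplices m).obj c.pt) :
      G s _ (α ((freeSimplex β).app _ y)) (x ((freeSimplex β).app _ y)) = G s m β y :=
    eq_of_freeChain_eq (C := c.pt) (fun m α x => G s m α x) (fun α f hf x => G_restrict s α f hf x)
      (hx ((freeSimplex β).app _ y)).symm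
  exact ⟨{
    desc := fun s => ↾fun y => G s _ (α y) (x y)
    fac := fun s j => by
      ext y
      obtain ⟨m, β, z, rfl⟩ := exists_freeSimplex_eq y
      refine Eq.trans ?_ (G_fac s m β j z)
      refine Eq.trans ?_ (G_eq s β ((simplices m).map (c.ι.app j) z))
      have := NatTrans.naturality_apply (freeSimplex β) (c.ι.app j) z
      exact congrArg (fun y => G s _ (α y) (x y)) this.symm
    uniq := fun s g hg => by
      ext y
      obtain ⟨j, z, hz⟩ := Types.jointly_surjective _ (hc _) (x y)
      change g y = G s _ (α y) (x y)
      rw [← hz]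
      refine Eq.trans ?_ (G_fac s _ (α y) j z).symm
      rw [← hg]
      refine congrArg g ((hx y).trans ?_)
      rw [← hz]
      exact NatTrans.naturality_apply (freeSimplex (α y)) (c.ι.app j) z }⟩

theorem nonempty_isColimit_iter (h : ∀ m, Nonempty (IsColimit ((simplices m).mapCocone c)))
    (k : ℕ) : Nonempty (IsColimit ((iter freeComonad k).mapCocone c)) := by
  have key (m) :
      Nonempty (IsColimit ((simplices m).mapCocone ((iter freeComonad k).mapCocone c))) := by
    induction k generalizing m with
    | zero => exact h m
    | succ k ih => exact nonempty_isColimit_free ((iter freeComonad k).mapCocone c) ih m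
  have : IsColimit (nerveFunctor.mapCocone ((iter freeComonad k).mapCocone c)) :=
    evaluationJointlyReflectsColimits _ fun m => (key m.unop.len).some
  exact ⟨isColimitOfReflects nerveFunctor this⟩

theorem nonempty_isColimit_freeResolution
    (h : ∀ m, Nonempty (IsColimit ((simplices m).mapCocone c))) :
    Nonempty (IsColimit (freeResolution.mapCocone c)) := by
  have : IsColimit (constantObjects.ι.mapCocone (freeResolution.mapCocone c)) :=
    evaluationJointlyReflectsColimits _ fun k =>
      (nonempty_isColimit_iter c h (k.unop.len + 1)).some
  exact ⟨isColimitOfReflects constantObjects.ι this⟩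

end NerveColimits

/-! ### A category as a colimit of its simplices -/

section Density

/-- The embedding of the simplex category in simplicial sets, typed as a functor so that its
costructured arrows get their category instance. -/
abbrev simplexEmbedding : SimplexCategory ⥤ SSet.{u} := SSet.stdSimplex.{u}

/-- The functor from the ordinal category to `Fin` that forgets the universe lift. -/
def downFunctor (k : SimplexCategory) : ordinal.{u}.obj k ⥤ Fin (k.len + 1) :=
  Monotone.functor (X := ULift.{u} (Fin (k.len + 1))) (f := ULift.down)
    fun _ _ h => ULift.down_le.2 h

/-- The functor `[k] ⥤ A` that corresponds to a `k`-simplex of the nerve of `A`. -/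
def simplexFunctor {A : Cat.{u, u}} {k : SimplexCategory} (x : SSet.stdSimplex.obj k ⟶ nerve A) :
    ordinal.obj k ⟶ A :=
  Functor.toCatHom (downFunctor k ⋙ SSet.yonedaEquiv x)

/-- The canonical cocone over the category of simplices of the nerve of `A`: its legs are the
functors `[k] ⥤ A`. -/
def simplexCocone (A : Cat.{u, u}) :
    Cocone (CostructuredArrow.proj simplexEmbedding.{u} (nerve A) ⋙ ordinal.{u}) where
  pt := A
  ι :=
    { app := fun x => simplexFunctor x.hom
      naturality := fun x y f => by
        have h : (ordinal.map f.left).toFunctor ⋙ (simplexFunctor y.hom).toFunctor =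
            (simplexFunctor x.hom).toFunctor := by
          rw [← CostructuredArrow.w f]
          exact congrArg (downFunctor x.left ⋙ ·)
            (SSet.yonedaEquiv_naturality f.left y.hom)
        exact congrArg Functor.toCatHom h }

/-- The nondegenerate top simplex of the nerve of the ordinal category `[m]`. -/
def topSimplex (m : ℕ) : Fin (m + 1) ⥤ ordinal.{u}.obj (SimplexCategory.mk m) :=
  Monotone.functor (Y := ULift.{u} (Fin (m + 1))) (f := ULift.up) fun _ _ h => ULift.up_le.2 h

/-- Density of the simplices: an `m`-simplex `y` of the nerve of `A` is the image of the top
simplex of `[m]` under the leg indexed by `y` itself. -/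
lemma nonempty_isColimit_simplexCocone (A : Cat.{u, u}) (m : ℕ) :
    Nonempty (IsColimit ((simplices m).mapCocone (simplexCocone A))) := by
  let e (y : (simplices m).obj A) : CostructuredArrow simplexEmbedding.{u} (nerve A) :=
    CostructuredArrow.mk (Y := SimplexCategory.mk m) (SSet.yonedaEquiv (X := nerve A) |>.symm y)
  have he (y : (simplices m).obj A) :
      (simplices m).map ((simplexCocone A).ι.app (e y)) (topSimplex m) = y :=
    (SSet.yonedaEquiv (X := nerve A) (n := SimplexCategory.mk m)).apply_symm_apply y
  exact ⟨{
    desc := fun s => ↾fun y => s.ι.app (e y) (topSimplex m)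
    fac := fun s x => by
      ext z
      let z' : Fin (m + 1) ⥤ ordinal.{u}.obj x.left := z
      let f : SimplexCategory.mk m ⟶ x.left :=
        SimplexCategory.mkHom ⟨(z' ⋙ downFunctor x.left).obj, (z' ⋙ downFunctor x.left).monotone⟩
      let y := (simplices m).map ((simplexCocone A).ι.app x) z
      have hf : simplexEmbedding.map f ≫ x.hom = SSet.yonedaEquiv.symm y := by
        apply SSet.yonedaEquiv.injective
        refine Eq.trans ?_ (Equiv.apply_symm_apply _ y).symm
        exact (SSet.yonedaEquiv_naturality f x.hom).symm
      refine (ConcreteCategory.congr_hom (s.w (CostructuredArrow.homMk f hf : e y ⟶ x))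
        (topSimplex m)).symm.trans ?_
      change s.ι.app x (topSimplex m ⋙ (ordinal.map f).toFunctor) = s.ι.app x z
      congr 1
    uniq := fun s g hg => by
      ext y
      refine (congrArg g (he y).symm).trans ?_
      exact ConcreteCategory.congr_hom (hg (e y)) (topSimplex m) }⟩

end Density

/-! ### The comparison with the realization of the nerve -/

/-- Both sides are colimits of the free resolutions of the ordinal categories over the simplices
of the nerve of `A`. -/
noncomputable def realizationNerveIso (A : Cat.{u, u}) :
    realization.obj (nerve A) ≅ freeResolution.obj A :=
  (colimit.isColimit (CostructuredArrow.proj simplexEmbedding.{u} (nerve A) ⋙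
    coherentSimplex)).coconePointUniqueUpToIso
    (nonempty_isColimit_freeResolution _ (nonempty_isColimit_simplexCocone A)).some

lemma ι_realizationNerveIso_hom (A : Cat.{u, u})
    (x : CostructuredArrow simplexEmbedding.{u} (nerve A)) :
    colimit.ι (CostructuredArrow.proj simplexEmbedding.{u} (nerve A) ⋙ coherentSimplex) x ≫
      (realizationNerveIso A).hom = freeResolution.map (simplexFunctor x.hom) :=
  IsColimit.comp_coconePointUniqueUpToIso_hom _ _ _

lemma realizationNerveIso_naturality {A B : Cat.{u, u}} (F : A ⟶ B) :
    realization.map (nerveFunctor.map F) ≫ (realizationNerveIso B).hom =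
      (realizationNerveIso A).hom ≫ freeResolution.map F := by
  refine (colimit.isColimit (CostructuredArrow.proj simplexEmbedding.{u} (nerve A) ⋙
    coherentSimplex)).hom_ext fun x => ?_
  have h₁ : colimit.ι (CostructuredArrow.proj simplexEmbedding.{u} (nerve A) ⋙
      coherentSimplex) x ≫ realization.map (nerveFunctor.map F) =
      colimit.ι (CostructuredArrow.proj simplexEmbedding.{u} (nerve B) ⋙ coherentSimplex)
        ((CostructuredArrow.map (nerveFunctor.map F)).obj x) :=
    colimit.ι_desc _ _
  have h₂ := ι_realizationNerveIso_hom A x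
  have h₃ := ι_realizationNerveIso_hom B ((CostructuredArrow.map (nerveFunctor.map F)).obj x)
  refine (Category.assoc _ _ _).symm.trans ?_
  refine (congrArg (· ≫ _) h₁).trans (h₃.trans ?_)
  refine Eq.trans ?_ ((congrArg (· ≫ _) h₂.symm).trans (Category.assoc _ _ _))
  rw [← Functor.map_comp]
  rfl

end HoCoh

theorem theorem2 :
    Nonempty (CategoryTheory.Iso HoCoh.freeResolution.{u}
      (CategoryTheory.Functor.comp CategoryTheory.nerveFunctor.{u, u} HoCoh.realization.{u})) :=
  ⟨(CategoryTheory.NatIso.ofComponents HoCoh.realizationNerveIso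
    HoCoh.realizationNerveIso_naturality).symm⟩
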